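/- Let $l, N \ge 0$ and $m_1,\dots,m_l \ge 0$ be integers, $\mathbf m = m_1+\cdots+m_l$, $H = S_{m_1}\times\cdots\times S_{m_l}\subset S_{\mathbf m}$ the subgroup preserving the blocks of $m_1,\dots,m_l$ consecutive points, and $h = |H| = \prod_{\alpha=1}^l m_\alpha!$. Permutations are multiplied from left to right: $(\sigma\tau)(k)=\tau(\sigma(k))$. For $N\times N$ complex matrices $X=(X_1,\dots,X_l)$ and $\sigma\in S_{\mathbf m}$ put $$\mathcal O_\sigma(X)=\mathrm{Tr}_{(\mathbb C^N)^{\otimes \mathbf m}}\big(X_1^{\otimes m_1}\otimes\cdots\otimes X_l^{\otimes m_l}\,\mathcal L_\sigma\big),\qquad \mathcal L_\sigma (e_{i_1}\otimes\cdots\otimes e_{i_{\mathbf m}}) = e_{i_{\sigma(1)}}\otimes\cdots\otimes e_{i_{\sigma(\mathbf m)}} .$$ Choose representatives of the irreducible unitary representations of $S_{\mathbf m}$, written $D^R$ on $V_R=\mathbb C^{d_R}$, and of each $S_{m_\alpha}$, labelled by the partitions of $\mathbf m$ and of $m_\alpha$ respectively. For each $R$ choose an orthonormal basis $|R;\mathbf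 r,\nu,\mathbf t\rangle$ of $V_R$ adapted to the decomposition $V_R=\bigoplus_{\mathbf r=(R_1,\dots,R_l)} V_{R_1}\otimes\cdots\otimes V_{R_l}\otimes V^R_{\mathbf r}$ under $H$; here $\nu$ indexes a basis of the multiplicity space $V^R_{\mathbf r}$, and for fixed $(\mathbf r,\nu)$ the vectors transform under $H$ like the product basis, indexed by $\mathbf t=(t_1,\dots,t_l)$, of $V_{R_1}\otimes\cdots\otimes V_{R_l}$. Define $P^R_{\mathbf r,\mu,\nu}=\sum_{\mathbf t}|R;\mathbf r,\mu,\mathbf t\rangle\langle R;\mathbf r,\nu,\mathbf t|$, $\chi^R_{\mathbf r,\mu,\nu}(\sigma)=\mathrm{Tr}\big(P^R_{\mathbf r,\mu,\nu}D^R(\sigma)\big)$, $$Q^R_{\mathbf r,\mu,\nu}=\frac{d_R}{\mathbf m!}\sum_{\sigma\in S_{\mathbf m}}\chi^R_{\mathbf r,\mu,\nu}(\sigma)\,\sigma^{-1}\in\mathbb C[S_{\mathbf m}],\qquad \mathcal O^R_{\mathbf r,\mu,\nu}(X)=\sum_{\sigma\in S_{\mathbf m}}\delta\big(Q^R_{\mathbf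 r,\mu,\nu}\,\sigma^{-1}\big)\,\mathcal O_\sigma(X),$$ where $\delta$ is the linear functional on $\mathbb C[S_{\mathbf m}]$ with $\delta(e)=1$ and $\delta(\sigma)=0$ for $\sigma\neq e$. The dagger of a scalar function is its complex conjugate. For positive definite Hermitian $N\times N$ matrices $A_1,\dots,A_l$ let $$\langle F\rangle_A=\frac{\int F(X)\prod_{\eta}e^{-\mathrm{Tr}(X_\eta A_\eta X_\eta^\dagger)}\,dX}{\int \prod_{\eta}e^{-\mathrm{Tr}(X_\eta A_\eta X_\eta^\dagger)}\,dX},$$ the integrals being over all complex entries of $X_1,\dots,X_l$ with respect to Lebesgue measure. Then, for all labels $R,S$, $\mathbf r,\mathbf s$ and multiplicity indices $\mu_1,\nu_1$ of $(R,\mathbf r)$ and $\mu_2,\nu_2$ of $(S,\mathbf s)$: (1) (coupling witnesses) for all positive definite Hermitian $A_1,\dots,A_l$, with $B_\eta=A_\eta^{-1}$, $$\big\langle \mathcal O^R_{\mathbf r,\mu_1,\nu_1}(X)\,\big(\mathcal O^S_{\mathbf s,\mu_2,\nu_2}(X)\big)^\dagger\big\rangle_A = h\,\delta^{RS}\delta_{\mathbf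 r\mathbf s}\delta_{\nu_1\nu_2}\,\mathcal O^R_{\mathbf r,\mu_1,\mu_2}(B_1,\dots,B_l);$$ (2) (classical witnesses) for arbitrary complex $N\times N$ matrices $A_1,\dots,A_l$, with $B_\eta=A_\eta^\dagger A_\eta$ and $\langle\cdot\rangle_{\mathbb I}$ the average with all couplings equal to the identity, $$\big\langle \mathcal O^R_{\mathbf r,\mu_1,\nu_1}(X_1A_1,\dots,X_lA_l)\,\big(\mathcal O^S_{\mathbf s,\mu_2,\nu_2}(X_1A_1,\dots,X_lA_l)\big)^\dagger\big\rangle_{\mathbb I} = h\,\delta^{RS}\delta_{\mathbf r\mathbf s}\delta_{\nu_1\nu_2}\,\mathcal O^R_{\mathbf r,\mu_1,\mu_2}(B_1,\dots,B_l).$$ In both cases the integrals converge absolutely and the denominator is non-zero. -/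

import Mathlib

open scoped BigOperators ComplexConjugate Nat ComplexOrder

noncomputable section

namespace MultiMatrix

/-- The symmetric group of a set `ι` of slots, with the convention that the *leftmost* permutation
acts first: `(σ τ)(k) = τ (σ k)`.  As Mathlib composes permutations from right to left, this is the
opposite of `Equiv.Perm ι`. -/
abbrev SymGroup (ι : Type) : Type := (Equiv.Perm ι)ᵐᵒᵖ

/-- A unitary irreducible matrix representation of `G` for every label `R : Λ`, with different
labels giving inequivalent representations.  It is used for `G` the symmetric group of an
`n`-element set and `Λ` the set of partitions of `n` (Young diagrams with `n` boxes); there the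
number of labels is the number of conjugacy classes, so that every irreducible representation
occurs exactly once. -/
structure IrrepSystem (G : Type) [Group G] (Λ : Type) where
  /-- the dimension `d_R` -/
  dim : Λ → ℕ
  /-- the representation `D^R` on `V_R = ℂ^{d_R}` -/
  rep : (R : Λ) → Representation ℂ G (EuclideanSpace ℂ (Fin (dim R)))
  unitary : ∀ (R : Λ) (g : G) (v w : EuclideanSpace ℂ (Fin (dim R))),
    inner ℂ (rep R g v) (rep R g w) = inner ℂ v w
  irreducible : ∀ R : Λ, (rep R).IsIrreducible
  inequivalent : ∀ R S : Λ, R ≠ S → IsEmpty ((rep R).Equiv (rep S))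

variable {l N : ℕ}

/-- The `𝐦 = m₁ + ⋯ + m_l` tensor slots, divided into `l` consecutive blocks, block `α` having
`m_α` slots. -/
abbrev Slot (m : Fin l → ℕ) : Type := Σ α : Fin l, Fin (m α)

/-- The inclusion of `S_{m₁} × ⋯ × S_{m_l}` in `S_𝐦` as the permutations that preserve the blocks. -/
def blockPerm {m : Fin l → ℕ} (γ : (α : Fin l) → SymGroup (Fin (m α))) : SymGroup (Slot m) :=
  MulOpposite.op (Equiv.Perm.sigmaCongrRight fun α => (γ α).unop)

/-- A complete choice of irreducible representations `D^R` of `S_𝐦`. -/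
abbrev BigIrreps (m : Fin l → ℕ) : Type :=
  IrrepSystem (SymGroup (Slot m)) (Nat.Partition (∑ α, m α))

/-- For every `α`, a complete choice of irreducible representations of `S_{m_α}`. -/
abbrev BlockIrreps (m : Fin l → ℕ) : Type :=
  (α : Fin l) → IrrepSystem (SymGroup (Fin (m α))) (Nat.Partition (m α))

/-- The labels `𝐫 = (R₁, …, R_l)` of the irreducible representations of `S_{m₁} × ⋯ × S_{m_l}`. -/
abbrev BlockLabel (m : Fin l → ℕ) : Type := (α : Fin l) → Nat.Partition (m α)

/-- An orthonormal basis `|R; 𝐫, ν, 𝐭⟩` of `V_R` adapted to the decomposition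
`V_R = ⨁_𝐫 V_{R₁} ⊗ ⋯ ⊗ V_{R_l} ⊗ V^R_𝐫` under `S_{m₁} × ⋯ × S_{m_l}`: for fixed `𝐫` and `ν`, the
vectors `|R; 𝐫, ν, 𝐭⟩` transform as the product basis of `V_{R₁} ⊗ ⋯ ⊗ V_{R_l}`, and `ν` runs over
`mult 𝐫 = dim V^R_𝐫` values. -/
structure AdaptedBasis {m : Fin l → ℕ} (D : BigIrreps m) (E : BlockIrreps m)
    (R : Nat.Partition (∑ α, m α)) where
  mult : BlockLabel m → ℕ
  ket : OrthonormalBasis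
    (Σ r : BlockLabel m, Fin (mult r) × ((α : Fin l) → Fin ((E α).dim (r α))))
    ℂ (EuclideanSpace ℂ (Fin (D.dim R)))
  ket_transform : ∀ (γ : (α : Fin l) → SymGroup (Fin (m α))) (r : BlockLabel m)
    (ν : Fin (mult r)) (t : (α : Fin l) → Fin ((E α).dim (r α))),
    D.rep R (blockPerm γ) (ket ⟨r, ν, t⟩) =
      ∑ t' : (α : Fin l) → Fin ((E α).dim (r α)),
        (∏ α, ((E α).rep (r α) (γ α) (EuclideanSpace.single (t α) 1)) (t' α)) • ket ⟨r, ν, t'⟩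

section QBasis

variable {m : Fin l → ℕ} {D : BigIrreps m} {E : BlockIrreps m} {R : Nat.Partition (∑ α, m α)}

/-- `P^R_{𝐫,μ,ν} = ∑_𝐭 |R; 𝐫, μ, 𝐭⟩⟨R; 𝐫, ν, 𝐭|`. -/
def AdaptedBasis.projOp (b : AdaptedBasis D E R) (r : BlockLabel m) (μ ν : Fin (b.mult r)) :
    EuclideanSpace ℂ (Fin (D.dim R)) →ₗ[ℂ] EuclideanSpace ℂ (Fin (D.dim R)) :=
  ∑ t : (α : Fin l) → Fin ((E α).dim (r α)),
    (InnerProductSpace.rankOne ℂ (b.ket ⟨r, μ, t⟩) (b.ket ⟨r, ν, t⟩)).toLinearMap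

/-- The restricted character `χ^R_{𝐫,μ,ν}(σ) = Tr (P^R_{𝐫,μ,ν} D^R(σ))`. -/
def AdaptedBasis.restrictedChar (b : AdaptedBasis D E R) (r : BlockLabel m)
    (μ ν : Fin (b.mult r)) (σ : SymGroup (Slot m)) : ℂ :=
  LinearMap.trace ℂ _ (b.projOp r μ ν ∘ₗ D.rep R σ)

/-- The `Q`-basis element `Q^R_{𝐫,μ,ν} = (d_R / 𝐦!) ∑_σ χ^R_{𝐫,μ,ν}(σ) σ⁻¹` of the group algebra. -/
def AdaptedBasis.Q (b : AdaptedBasis D E R) (r : BlockLabel m) (μ ν : Fin (b.mult r)) :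
    MonoidAlgebra ℂ (SymGroup (Slot m)) :=
  ((D.dim R : ℂ) / ((∑ α, m α)! : ℂ)) •
    ∑ π : Equiv.Perm (Slot m),
      MonoidAlgebra.single (MulOpposite.op π)⁻¹ (b.restrictedChar r μ ν (MulOpposite.op π))

end QBasis

/-- The linear functional `δ` on a group algebra: `δ(e) = 1` and `δ(g) = 0` for `g ≠ e`. -/
def delta {G : Type} [Group G] (a : MonoidAlgebra ℂ G) : ℂ := a.coeff 1

/-- The operator `X₁^{⊗ m₁} ⊗ ⋯ ⊗ X_l^{⊗ m_l}` on `V_N^{⊗ 𝐦}`, in the product basis `e_I`, with `I`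
a multi-index. -/
def tensorOp (m : Fin l → ℕ) (X : Fin l → Matrix (Fin N) (Fin N) ℂ) :
    Matrix (Slot m → Fin N) (Slot m → Fin N) ℂ :=
  Matrix.of fun I J => ∏ k : Slot m, X k.1 (I k) (J k)

/-- The operator `𝓛_σ` on `V_N^{⊗ 𝐦}`, which sends `e_I` to `e_{I ∘ σ}`. -/
def permOp {m : Fin l → ℕ} (N : ℕ) (σ : SymGroup (Slot m)) :
    Matrix (Slot m → Fin N) (Slot m → Fin N) ℂ :=
  Matrix.of fun J I => if J = I ∘ σ.unop then 1 else 0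

/-- The gauge-invariant operator
`𝓞_σ(X) = Tr_{V_N^{⊗ 𝐦}} (X₁^{⊗ m₁} ⊗ ⋯ ⊗ X_l^{⊗ m_l} 𝓛_σ)`. -/
def permObs {m : Fin l → ℕ} (σ : SymGroup (Slot m)) (X : Fin l → Matrix (Fin N) (Fin N) ℂ) : ℂ :=
  (tensorOp m X * permOp N σ).trace

/-- The expansion `𝓞_σ(X) = ∑_I ∏_k (X_{α(k)})^{i_k}_{i_{σ(k)}}`. -/
theorem permObs_eq {m : Fin l → ℕ} (σ : SymGroup (Slot m))
    (X : Fin l → Matrix (Fin N) (Fin N) ℂ) :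
    permObs σ X = ∑ I : Slot m → Fin N, ∏ k : Slot m, X k.1 (I k) (I (σ.unop k)) := by
  simp [permObs, Matrix.trace, Matrix.mul_apply, tensorOp, permOp]

/-- The Fourier basis operator
`𝓞^R_{𝐫,μ,ν}(X) = ∑_σ δ(Q^R_{𝐫,μ,ν} σ⁻¹) 𝓞_σ(X)`. -/
def AdaptedBasis.fourierObs {m : Fin l → ℕ} {D : BigIrreps m} {E : BlockIrreps m}
    {R : Nat.Partition (∑ α, m α)} (b : AdaptedBasis D E R) (r : BlockLabel m)
    (μ ν : Fin (b.mult r)) (X : Fin l → Matrix (Fin N) (Fin N) ℂ) : ℂ :=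
  ∑ π : Equiv.Perm (Slot m),
    delta (b.Q r μ ν * MonoidAlgebra.single (MulOpposite.op π)⁻¹ 1) *
      permObs (MulOpposite.op π) X

/-- The Gaussian weight `∏_η exp(-Tr(X_η A_η X_η†))`. -/
def weight (A X : Fin l → Matrix (Fin N) (Fin N) ℂ) : ℂ :=
  ∏ η, Complex.exp (-(X η * A η * (X η).conjTranspose).trace)

/-- The matrices with the given entries; the entries are the integration variables. -/
def toMatrices (x : Fin l → Fin N → Fin N → ℂ) : Fin l → Matrix (Fin N) (Fin N) ℂ :=
  fun η => Matrix.of (x η)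

/-- `⟨F⟩ = c` in the Gaussian model with coupling matrices `A`: all the integrals, over all complex
entries of `X₁, …, X_l` with respect to Lebesgue measure, converge absolutely, the partition
function does not vanish, and
`(∫ F(X) ∏_η exp(-Tr(X_η A_η X_η†)) dX) / (∫ ∏_η exp(-Tr(X_η A_η X_η†)) dX) = c`. -/
def HasCorrelator (A : Fin l → Matrix (Fin N) (Fin N) ℂ)
    (F : (Fin l → Matrix (Fin N) (Fin N) ℂ) → ℂ) (c : ℂ) : Prop :=
  MeasureTheory.Integrable (fun x : Fin l → Fin N → Fin N → ℂ => weight A (toMatrices x)) ∧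
  (∫ x : Fin l → Fin N → Fin N → ℂ, weight A (toMatrices x)) ≠ 0 ∧
  MeasureTheory.Integrable
    (fun x : Fin l → Fin N → Fin N → ℂ => F (toMatrices x) * weight A (toMatrices x)) ∧
  (∫ x : Fin l → Fin N → Fin N → ℂ, F (toMatrices x) * weight A (toMatrices x)) /
    (∫ x : Fin l → Fin N → Fin N → ℂ, weight A (toMatrices x)) = c

/-- The right-hand side `h δ^{RS} δ_{𝐫𝐬} δ_{ν₁ν₂} 𝓞^R_{𝐫,μ₁,μ₂}(B)` with `h = ∏_α m_α!`.  The
multiplicity indices of `(R, 𝐫)` and of `(S, 𝐬)` are only compared when `R = S` and `𝐫 = 𝐬`. -/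
def orthogonalValue {m : Fin l → ℕ} {D : BigIrreps m} {E : BlockIrreps m}
    (b : (R : Nat.Partition (∑ α, m α)) → AdaptedBasis D E R)
    {R S : Nat.Partition (∑ α, m α)} {r s : BlockLabel m}
    (μ₁ ν₁ : Fin ((b R).mult r)) (μ₂ ν₂ : Fin ((b S).mult s))
    (B : Fin l → Matrix (Fin N) (Fin N) ℂ) : ℂ :=
  if e : R = S ∧ r = s then
    have e' : (b S).mult s = (b R).mult r := by rw [e.2]; cases e.1; rfl
    if ν₁ = Fin.cast e' ν₂ then
      (∏ α, ((m α)! : ℂ)) * (b R).fourierObs r μ₁ (Fin.cast e' μ₂) B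
    else 0
  else 0

end MultiMatrix

end

/-!
Both averages are reduced to the standard Gaussian measure, under which all matrix entries are
independent. A positive definite coupling is `A = C C†` with `C` invertible, and the substitution
`Y = X C` has a constant Jacobian that cancels in the quotient; it turns the average with
couplings `A` into the standard average of operators in the matrices `Y C⁻¹`
(`hasCorrelator_mul_conjTranspose`). Thus the coupling witnesses are classical witnesses for
`C⁻¹`, with `(C⁻¹)† C⁻¹ = A⁻¹`.

For the standard average, Wick's theorem (`hasMoment_wick_blocks`) pairs the entries of the `X`'s
with those of their conjugates in all ways that respect the blocks. It is proved by collecting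
equal entries, so that only the moments `∫ z^p z̄^q exp(-|z|²) = δ_{pq} p! π` of one variable are
needed (`hasMoment_gaussWeight`), and by observing that the resulting product of factorials counts
the pairings (`sum_perm_ite_eq_prod`). Contracting indices gives, with `B = A† A`,
`⟨𝓞_σ(XA) 𝓞_τ(XA)†⟩ = ∑_γ 𝓞_{γ⁻¹σγτ⁻¹}(B)`, the sum being over `γ` in the block subgroup `H`
(`hasMoment_permObs`).

In the Fourier basis, restricted characters are invariant under conjugation by `H`
(`AdaptedBasis.restrictedChar_conj`), so the sum over `γ` only produces the factor `h = |H|`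
(`hasMoment_fourierObs`). What remains is a convolution of two restricted characters, which Schur
orthogonality for the matrix elements of irreducible representations evaluates
(`sum_restrictedChar_mul_of_ne`, `AdaptedBasis.dim_mul_sum_restrictedChar_mul_of_ne`,
`AdaptedBasis.dim_mul_sum_restrictedChar_mul_self`).
-/

noncomputable section

namespace MultiMatrix

/-! ### Schur orthogonality -/

section Schur

variable {G V W : Type*} [Group G] [Fintype G]
  [NormedAddCommGroup V] [InnerProductSpace ℂ V]
  [NormedAddCommGroup W] [InnerProductSpace ℂ W]

/-- The sum `∑_g ρ(g⁻¹) |b⟩⟨c| σ(g)`, that is, the group average of a rank one map without its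
normalisation. It intertwines `σ` and `ρ`, so Schur's lemma applies to it. -/
def averageRankOne (ρ : Representation ℂ G V) (σ : Representation ℂ G W) (b : V) (c : W) :
    Representation.IntertwiningMap σ ρ where
  toLinearMap := ∑ g : G, ρ g⁻¹ ∘ₗ (InnerProductSpace.rankOne ℂ b c).toLinearMap ∘ₗ σ g
  isIntertwining' h := by
    ext v
    simp only [LinearMap.comp_apply, LinearMap.sum_apply, map_sum]
    refine Fintype.sum_equiv (Equiv.mulRight h) _ _ fun g => ?_
    rw [show ρ g⁻¹ = ρ h * ρ (g * h)⁻¹ by simp [← map_mul]]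
    simp [map_mul]

theorem averageRankOne_apply (ρ : Representation ℂ G V) (σ : Representation ℂ G W)
    (b : V) (c w : W) :
    averageRankOne ρ σ b c w = ∑ g : G, inner ℂ c (σ g w) • ρ g⁻¹ b := by
  change (∑ g : G, ρ g⁻¹ ∘ₗ (InnerProductSpace.rankOne ℂ b c).toLinearMap ∘ₗ σ g) w = _
  simp

theorem inner_averageRankOne (ρ : Representation ℂ G V) (σ : Representation ℂ G W)
    (a b : V) (c w : W) :
    inner ℂ a (averageRankOne ρ σ b c w) =
      ∑ g : G, inner ℂ a (ρ g⁻¹ b) * inner ℂ c (σ g w) := by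
  simp [averageRankOne_apply, mul_comm]

/-- Schur orthogonality for inequivalent irreducible representations. -/
theorem sum_inner_mul_inner_eq_zero (ρ : Representation ℂ G V) (σ : Representation ℂ G W)
    [ρ.IsIrreducible] [σ.IsIrreducible] (h : IsEmpty (σ.Equiv ρ)) (a b : V) (c w : W) :
    ∑ g : G, inner ℂ a (ρ g⁻¹ b) * inner ℂ c (σ g w) = 0 := by
  rw [← inner_averageRankOne, Subsingleton.elim (averageRankOne ρ σ b c) 0]
  simp

/-- Schur orthogonality for the matrix elements of one irreducible representation. -/
theorem finrank_mul_sum_inner_mul_inner [FiniteDimensional ℂ V] (ρ : Representation ℂ G V)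
    [ρ.IsIrreducible] (a b c d : V) :
    (Module.finrank ℂ V : ℂ) * ∑ g : G, inner ℂ a (ρ g⁻¹ b) * inner ℂ c (ρ g d) =
      Fintype.card G * (inner ℂ a d * inner ℂ c b) := by
  obtain ⟨z, hz⟩ := (Representation.IsIrreducible.algebraMap_intertwiningMap_bijective_of_isAlgClosed
    (ρ := ρ)).2 (averageRankOne ρ ρ b c)
  have hlin : ∑ g : G, ρ g⁻¹ ∘ₗ (InnerProductSpace.rankOne ℂ b c).toLinearMap ∘ₗ ρ g =
      z • LinearMap.id := by
    ext v
    change averageRankOne ρ ρ b c v = _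
    rw [← hz]; rfl
  -- The scalar is found by taking traces.
  have htr : (Fintype.card G : ℂ) * inner ℂ c b = z * Module.finrank ℂ V := by
    have := congrArg (LinearMap.trace ℂ V) hlin
    rw [map_sum, map_smul, LinearMap.trace_id, smul_eq_mul] at this
    rw [← this, Finset.sum_congr rfl (g := fun _ => inner ℂ c b)]
    · simp
    intro g _
    rw [LinearMap.trace_comp_comm', LinearMap.comp_assoc, ← Module.End.mul_eq_comp (ρ g),
      ← map_mul, mul_inv_cancel, map_one, Module.End.one_eq_id, LinearMap.comp_id]
    exact InnerProductSpace.trace_rankOne b c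
  rw [← inner_averageRankOne, ← hz]
  rw [show (algebraMap ℂ (Representation.IntertwiningMap ρ ρ) z) d = z • d from rfl,
    inner_smul_right]
  linear_combination - inner ℂ a d * htr

end Schur

/-! ### Restricted characters -/

section Characters

variable {l : ℕ} {m : Fin l → ℕ} {D : BigIrreps m} {E : BlockIrreps m}
  {R : Nat.Partition (∑ α, m α)}

instance (ι : Type) [Fintype ι] [DecidableEq ι] : Fintype (SymGroup ι) :=
  Fintype.ofEquiv _ MulOpposite.opEquiv

theorem AdaptedBasis.restrictedChar_eq (b : AdaptedBasis D E R) (r : BlockLabel m)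
    (μ ν : Fin (b.mult r)) (σ : SymGroup (Slot m)) :
    b.restrictedChar r μ ν σ =
      ∑ t, inner ℂ (b.ket ⟨r, ν, t⟩) (D.rep R σ (b.ket ⟨r, μ, t⟩)) := by
  have h : b.projOp r μ ν ∘ₗ D.rep R σ = ∑ t,
      (InnerProductSpace.rankOne ℂ (b.ket ⟨r, μ, t⟩) (b.ket ⟨r, ν, t⟩)).toLinearMap ∘ₗ
        D.rep R σ := by
    ext v : 1
    simp only [projOp, LinearMap.comp_apply, LinearMap.sum_apply]
  rw [restrictedChar, h, map_sum]
  refine Finset.sum_congr rfl fun t _ => ?_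
  rw [LinearMap.trace_comp_comm']
  rw [← InnerProductSpace.trace_rankOne]
  congr 1
  ext v : 1
  simp

theorem IrrepSystem.inner_rep_left {G Λ : Type} [Group G] (D : IrrepSystem G Λ) (R : Λ) (g : G)
    (v w : EuclideanSpace ℂ (Fin (D.dim R))) :
    inner ℂ (D.rep R g v) w = inner ℂ v (D.rep R g⁻¹ w) := by
  rw [← D.unitary R g v, ← Module.End.mul_apply, ← map_mul, mul_inv_cancel, map_one]
  rfl

/-- Unitarity of `D^R` turns complex conjugation into inversion, exchanging the multiplicity
indices. -/
theorem AdaptedBasis.conj_restrictedChar (b : AdaptedBasis D E R) (r : BlockLabel m)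
    (μ ν : Fin (b.mult r)) (σ : SymGroup (Slot m)) :
    conj (b.restrictedChar r μ ν σ) = b.restrictedChar r ν μ σ⁻¹ := by
  simp only [restrictedChar_eq, map_sum, inner_conj_symm, D.inner_rep_left]

theorem blockPerm_inv (γ : (α : Fin l) → SymGroup (Fin (m α))) :
    blockPerm (γ⁻¹) = (blockPerm γ)⁻¹ := rfl

/-- The matrix element of a block permutation between the product basis vectors of
`V_{R₁} ⊗ ⋯ ⊗ V_{R_l}` with labels `t'` and `t`. -/
def blockCoeff (E : BlockIrreps m) (r : BlockLabel m)
    (γ : (α : Fin l) → SymGroup (Fin (m α))) (t' t : (α : Fin l) → Fin ((E α).dim (r α))) : ℂ :=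
  ∏ α, ((E α).rep (r α) (γ α) (EuclideanSpace.single (t α) 1)) (t' α)

/-- The operators `P^R_{𝐫,μ,ν}` commute with the block permutations, so restricted characters are
invariant under conjugation by these. The reason is that a block permutation acts on
`|R; 𝐫, μ, 𝐭⟩` and on `|R; 𝐫, ν, 𝐭⟩` by the same unitary matrix in `𝐭`. -/
theorem AdaptedBasis.restrictedChar_conj (b : AdaptedBasis D E R) (r : BlockLabel m)
    (μ ν : Fin (b.mult r)) (γ : (α : Fin l) → SymGroup (Fin (m α))) (σ : SymGroup (Slot m)) :
    b.restrictedChar r μ ν (blockPerm γ * σ * (blockPerm γ)⁻¹) = b.restrictedChar r μ ν σ := by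
  set M : Matrix ((α : Fin l) → Fin ((E α).dim (r α))) ((α : Fin l) → Fin ((E α).dim (r α))) ℂ :=
    Matrix.of (blockCoeff E r γ⁻¹) with hM
  have hket (κ : Fin (b.mult r)) (t) : D.rep R (blockPerm γ)⁻¹ (b.ket ⟨r, κ, t⟩) =
      ∑ t', M t' t • b.ket ⟨r, κ, t'⟩ := by
    rw [← blockPerm_inv, b.ket_transform]; rfl
  -- As `D^R` is unitary and the adapted basis orthonormal, `M` is unitary.
  have hunit : M.conjTranspose * M = 1 := by
    ext t t'
    have h := D.unitary R (blockPerm γ)⁻¹ (b.ket ⟨r, ν, t⟩) (b.ket ⟨r, ν, t'⟩)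
    rw [hket, hket] at h
    simp only [sum_inner, inner_sum, inner_smul_left, inner_smul_right,
      orthonormal_iff_ite.1 b.ket.orthonormal] at h
    simpa [Matrix.mul_apply, Matrix.one_apply, mul_comm] using h
  have hunit' (s s') : ∑ t, M s t * conj (M s' t) = if s = s' then 1 else 0 := by
    have hcomm : M * M.conjTranspose = 1 := mul_eq_one_comm.1 hunit
    have := congrFun (congrFun hcomm s) s'
    simpa [Matrix.mul_apply, Matrix.one_apply] using this
  rw [restrictedChar_eq, restrictedChar_eq]
  calc ∑ t, inner ℂ (b.ket ⟨r, ν, t⟩)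
        (D.rep R (blockPerm γ * σ * (blockPerm γ)⁻¹) (b.ket ⟨r, μ, t⟩))
      = ∑ t, inner ℂ (D.rep R (blockPerm γ)⁻¹ (b.ket ⟨r, ν, t⟩))
        (D.rep R σ (D.rep R (blockPerm γ)⁻¹ (b.ket ⟨r, μ, t⟩))) := by
        simp [D.inner_rep_left, map_mul]
    _ = ∑ t, ∑ s, ∑ s', (M s t * conj (M s' t)) *
          inner ℂ (b.ket ⟨r, ν, s'⟩) (D.rep R σ (b.ket ⟨r, μ, s⟩)) := by
        simp only [hket, map_sum, map_smul, sum_inner, inner_sum, inner_smul_left,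
          inner_smul_right, Finset.mul_sum]
        refine Finset.sum_congr rfl fun t _ => Finset.sum_congr rfl fun s _ => ?_
        refine Finset.sum_congr rfl fun s' _ => ?_
        ring
    _ = ∑ s, ∑ s', (∑ t, M s t * conj (M s' t)) *
          inner ℂ (b.ket ⟨r, ν, s'⟩) (D.rep R σ (b.ket ⟨r, μ, s⟩)) := by
        simp only [Finset.sum_mul]
        rw [Finset.sum_comm]
        exact Finset.sum_congr rfl fun s _ => Finset.sum_comm
    _ = _ := by simp [hunit']

theorem sum_restrictedChar_mul_of_ne {S : Nat.Partition (∑ α, m α)} (hRS : R ≠ S)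
    (b : AdaptedBasis D E R) (c : AdaptedBasis D E S) (r s : BlockLabel m)
    (μ₁ ν₁ : Fin (b.mult r)) (μ₂ ν₂ : Fin (c.mult s)) (x : SymGroup (Slot m)) :
    ∑ τ, b.restrictedChar r μ₁ ν₁ (τ⁻¹ * x) * c.restrictedChar s ν₂ μ₂ τ = 0 := by
  have := D.irreducible R
  have := D.irreducible S
  simp only [AdaptedBasis.restrictedChar_eq, Finset.sum_mul_sum, map_mul, Module.End.mul_apply]
  rw [Finset.sum_comm]
  refine Finset.sum_eq_zero fun t _ => ?_
  rw [Finset.sum_comm]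
  refine Finset.sum_eq_zero fun t' _ => ?_
  exact sum_inner_mul_inner_eq_zero _ _ (D.inequivalent S R hRS.symm) _ _ _ _

/-- Schur orthogonality for the convolution of two restricted characters of one `D^R`, before the
orthonormality of the adapted basis is used. -/
theorem AdaptedBasis.dim_mul_sum_restrictedChar_mul (b : AdaptedBasis D E R) (r s : BlockLabel m)
    (μ₁ ν₁ : Fin (b.mult r)) (μ₂ ν₂ : Fin (b.mult s)) (x : SymGroup (Slot m)) :
    (D.dim R : ℂ) * ∑ τ, b.restrictedChar r μ₁ ν₁ (τ⁻¹ * x) * b.restrictedChar s ν₂ μ₂ τ =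
      (∑ α, m α)! * ∑ t, ∑ t', inner ℂ (b.ket ⟨r, ν₁, t⟩) (b.ket ⟨s, ν₂, t'⟩) *
        inner ℂ (b.ket ⟨s, μ₂, t'⟩) (D.rep R x (b.ket ⟨r, μ₁, t⟩)) := by
  have := D.irreducible R
  have hcard : Fintype.card (SymGroup (Slot m)) = (∑ α, m α)! := by
    rw [Fintype.card_congr MulOpposite.opEquiv.symm, Fintype.card_perm]
    simp
  simp only [AdaptedBasis.restrictedChar_eq, Finset.sum_mul_sum, map_mul, Module.End.mul_apply]
  rw [Finset.sum_comm, Finset.mul_sum, Finset.mul_sum]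
  refine Finset.sum_congr rfl fun t _ => ?_
  rw [Finset.sum_comm, Finset.mul_sum, Finset.mul_sum]
  refine Finset.sum_congr rfl fun t' _ => ?_
  have h := finrank_mul_sum_inner_mul_inner (D.rep R) (b.ket ⟨r, ν₁, t⟩)
    (D.rep R x (b.ket ⟨r, μ₁, t⟩)) (b.ket ⟨s, μ₂, t'⟩) (b.ket ⟨s, ν₂, t'⟩)
  rw [finrank_euclideanSpace_fin, hcard] at h
  exact h

theorem AdaptedBasis.dim_mul_sum_restrictedChar_mul_of_ne (b : AdaptedBasis D E R)
    {r s : BlockLabel m} (hrs : r ≠ s)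
    (μ₁ ν₁ : Fin (b.mult r)) (μ₂ ν₂ : Fin (b.mult s)) (x : SymGroup (Slot m)) :
    (D.dim R : ℂ) * ∑ τ, b.restrictedChar r μ₁ ν₁ (τ⁻¹ * x) * b.restrictedChar s ν₂ μ₂ τ = 0 := by
  rw [dim_mul_sum_restrictedChar_mul]
  have h (t t') : inner ℂ (b.ket ⟨r, ν₁, t⟩) (b.ket ⟨s, ν₂, t'⟩) = 0 :=
    b.ket.orthonormal.2 fun h => hrs (congrArg Sigma.fst h)
  simp [h]

/-- Restricted characters of the same `R` and `𝐫` multiply under convolution like matrix units. -/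
theorem AdaptedBasis.dim_mul_sum_restrictedChar_mul_self (b : AdaptedBasis D E R)
    (r : BlockLabel m) (μ₁ ν₁ μ₂ ν₂ : Fin (b.mult r)) (x : SymGroup (Slot m)) :
    (D.dim R : ℂ) * ∑ τ, b.restrictedChar r μ₁ ν₁ (τ⁻¹ * x) * b.restrictedChar r ν₂ μ₂ τ =
      if ν₁ = ν₂ then (∑ α, m α)! * b.restrictedChar r μ₁ μ₂ x else 0 := by
  rw [dim_mul_sum_restrictedChar_mul]
  simp only [orthonormal_iff_ite.1 b.ket.orthonormal, restrictedChar_eq]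
  split_ifs with h <;> simp [h]

end Characters

/-! ### Moments of a weight -/

section Moments

open MeasureTheory

/-- `F` has the (absolutely convergent) moment `c` with respect to the unnormalised weight `w`:
`∫ F w = c ∫ w`. -/
def HasMoment {E : Type*} [MeasureSpace E] (w F : E → ℂ) (c : ℂ) : Prop :=
  Integrable (fun x => F x * w x) ∧ ∫ x, F x * w x = c * ∫ x, w x

namespace HasMoment

variable {E : Type*} [MeasureSpace E] {w : E → ℂ}

theorem const_mul {F : E → ℂ} {c : ℂ} (h : HasMoment w F c) (a : ℂ) :
    HasMoment w (fun x => a * F x) (a * c) := by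
  refine ⟨by simpa only [mul_assoc] using h.1.const_mul a, ?_⟩
  simp only [mul_assoc, integral_const_mul, h.2]

theorem sum {ι : Type*} (s : Finset ι) {F : ι → E → ℂ} {c : ι → ℂ}
    (h : ∀ i ∈ s, HasMoment w (F i) (c i)) :
    HasMoment w (fun x => ∑ i ∈ s, F i x) (∑ i ∈ s, c i) := by
  simp only [HasMoment, Finset.sum_mul]
  refine ⟨integrable_finsetSum _ fun i hi => (h i hi).1, ?_⟩
  rw [integral_finsetSum _ fun i hi => (h i hi).1]
  exact Finset.sum_congr rfl fun i hi => (h i hi).2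

/-- Fubini's theorem for the moments of a product of functions of independent variables. -/
theorem pi {ι : Type*} [Fintype ι] [SigmaFinite (volume : Measure E)] {w F : ι → E → ℂ}
    {c : ι → ℂ} (h : ∀ i, HasMoment (w i) (F i) (c i)) :
    HasMoment (fun x : ι → E => ∏ i, w i (x i)) (fun x => ∏ i, F i (x i)) (∏ i, c i) := by
  simp only [HasMoment, ← Finset.prod_mul_distrib]
  refine ⟨Integrable.fintype_prod fun i => (h i).1, ?_⟩
  rw [integral_fintype_prod_volume_eq_prod fun i x => F i x * w i x,
    integral_fintype_prod_volume_eq_prod w, ← Finset.prod_mul_distrib]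
  exact Finset.prod_congr rfl fun i _ => (h i).2

end HasMoment

section LinearSubstitution

variable {E : Type*} [NormedAddCommGroup E] [NormedSpace ℝ E] [MeasureSpace E]
  [BorelSpace E] [FiniteDimensional ℝ E]

theorem measurableEmbedding_linearEquiv (L : E ≃ₗ[ℝ] E) : MeasurableEmbedding L :=
  L.toContinuousLinearEquiv.toHomeomorph.measurableEmbedding

variable [(volume : Measure E).IsAddHaarMeasure]

theorem map_linearEquiv_volume (L : E ≃ₗ[ℝ] E) :
    Measure.map L (volume : Measure E) =
      ENNReal.ofReal |(LinearMap.det L.toLinearMap)⁻¹| • (volume : Measure E) :=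
  Measure.map_linearMap_addHaar_eq_smul_addHaar volume (f := L.toLinearMap) L.isUnit_det'.ne_zero

theorem integral_comp_linearEquiv (L : E ≃ₗ[ℝ] E) (f : E → ℂ) :
    ∫ x, f (L x) = |(LinearMap.det L.toLinearMap)⁻¹| • ∫ x, f x := by
  rw [← (measurableEmbedding_linearEquiv L).integral_map f, map_linearEquiv_volume,
    integral_smul_measure, ENNReal.toReal_ofReal (abs_nonneg _)]

theorem integral_comp_linearEquiv_ne_zero (L : E ≃ₗ[ℝ] E) {f : E → ℂ} (hf : ∫ x, f x ≠ 0) :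
    ∫ x, f (L x) ≠ 0 := by
  rw [integral_comp_linearEquiv]
  exact smul_ne_zero (abs_ne_zero.2 (inv_ne_zero L.isUnit_det'.ne_zero)) hf

/-- Moments are unchanged under an invertible linear substitution, whose Jacobian is constant. -/
theorem HasMoment.comp_linearEquiv {w F : E → ℂ} {c : ℂ} (h : HasMoment w F c) (L : E ≃ₗ[ℝ] E) :
    HasMoment (fun x => w (L x)) (fun x => F (L x)) c := by
  refine ⟨((measurableEmbedding_linearEquiv L).integrable_map_iff
    (g := fun x => F x * w x)).1 ?_, ?_⟩
  · rw [map_linearEquiv_volume]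
    exact h.1.smul_measure ENNReal.ofReal_ne_top
  · rw [integral_comp_linearEquiv L fun x => F x * w x, integral_comp_linearEquiv L w, h.2,
      mul_smul_comm]

end LinearSubstitution

/-! ### One complex Gaussian variable -/

/-- The standard Gaussian weight `exp(-|z|²)` on `ℂ`. -/
def gaussWeight (z : ℂ) : ℂ := Complex.exp (-(z * conj z))

theorem gaussWeight_eq (z : ℂ) : gaussWeight z = (Real.exp (-‖z‖ ^ (2 : ℝ)) : ℝ) := by
  rw [gaussWeight, Complex.mul_conj, Complex.normSq_eq_norm_sq]
  norm_cast

theorem integral_norm_pow_mul_exp (n : ℕ) :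
    ∫ z : ℂ, ‖z‖ ^ n * Real.exp (-‖z‖ ^ (2 : ℝ)) = Real.pi * Real.Gamma ((n + 2) / 2) := by
  have h := Complex.integral_rpow_mul_exp_neg_rpow (p := 2) (q := n) one_le_two
    (by linarith [n.cast_nonneg (α := ℝ)])
  simpa using h

theorem integrable_norm_pow_mul_exp (n : ℕ) :
    Integrable fun z : ℂ => ‖z‖ ^ n * Real.exp (-‖z‖ ^ (2 : ℝ)) := by
  -- The integral of a function that is not integrable is zero by convention.
  refine Integrable.of_integral_ne_zero ?_
  rw [integral_norm_pow_mul_exp]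
  exact (mul_pos Real.pi_pos (Real.Gamma_pos_of_pos (by positivity))).ne'

theorem integral_gaussWeight : ∫ z, gaussWeight z = Real.pi := by
  have h := integral_norm_pow_mul_exp 0
  simp only [pow_zero, one_mul] at h
  simp only [gaussWeight_eq]
  rw [integral_complex_ofReal, h]
  simp

/-- The moments of the standard complex Gaussian: those with `p ≠ q` vanish by rotation
invariance, those with `p = q` are radial integrals. -/
theorem hasMoment_gaussWeight (p q : ℕ) :
    HasMoment gaussWeight (fun z => z ^ p * conj z ^ q) (if p = q then (p ! : ℂ) else 0) := by
  refine ⟨?_, ?_⟩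
  · refine (integrable_norm_pow_mul_exp (p + q)).mono ?_ (.of_forall fun z => ?_)
    · refine Continuous.aestronglyMeasurable ?_
      unfold gaussWeight
      fun_prop
    · rw [gaussWeight_eq, norm_mul, norm_mul, norm_pow, norm_pow, RCLike.norm_conj,
        Complex.norm_real, Real.norm_of_nonneg (Real.exp_pos _).le, ← pow_add]
      exact le_abs_self _
  split_ifs with h
  · subst h
    have h2 := integral_norm_pow_mul_exp (2 * p)
    have h3 (z : ℂ) : z ^ p * conj z ^ p * gaussWeight z =
        ((‖z‖ ^ (2 * p) * Real.exp (-‖z‖ ^ (2 : ℝ)) : ℝ) : ℂ) := by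
      rw [← mul_pow, Complex.mul_conj, Complex.normSq_eq_norm_sq, gaussWeight_eq]
      push_cast
      rw [pow_mul]
    simp only [h3]
    rw [integral_complex_ofReal, h2, integral_gaussWeight,
      show (((2 * p : ℕ) : ℝ) + 2) / 2 = p + 1 by push_cast; ring, Real.Gamma_nat_eq_factorial]
    push_cast
    ring
  · rw [zero_mul]
    -- The rotation by this angle changes the sign of the integrand.
    set θ : ℝ := Real.pi / ((p : ℝ) - q) with hθ
    have hpq : (p : ℝ) - q ≠ 0 := sub_ne_zero.2 (by exact_mod_cast h)
    have key := (rotation (Circle.exp θ)).measurePreserving.integral_comp'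
      (f := (rotation (Circle.exp θ)).toHomeomorph.toMeasurableEquiv)
      (fun z => z ^ p * conj z ^ q * gaussWeight z)
    have hsign : (Circle.exp θ : ℂ) ^ p * conj (Circle.exp θ : ℂ) ^ q = -1 := by
      rw [Circle.coe_exp, ← Complex.exp_conj, ← Complex.exp_nat_mul, ← Complex.exp_nat_mul,
        ← Complex.exp_add, ← Complex.exp_pi_mul_I]
      congr 1
      have : (p : ℂ) * θ - q * θ = Real.pi := by
        norm_cast
        rw [hθ]; field_simp
      simp only [map_mul, Complex.conj_I, Complex.conj_ofReal]
      linear_combination this * Complex.I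
    have hw (z : ℂ) : gaussWeight (Circle.exp θ * z) = gaussWeight z := by
      simp [gaussWeight_eq]
    have hrot (z : ℂ) : (Circle.exp θ * z : ℂ) ^ p * conj (Circle.exp θ * z : ℂ) ^ q *
        gaussWeight (Circle.exp θ * z) = - (z ^ p * conj z ^ q * gaussWeight z) := by
      rw [hw, map_mul, mul_pow, mul_pow]
      linear_combination z ^ p * conj z ^ q * gaussWeight z * hsign
    have key2 : ∫ z : ℂ, - (z ^ p * conj z ^ q * gaussWeight z) =
        ∫ z : ℂ, z ^ p * conj z ^ q * gaussWeight z := by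
      rw [← key]
      refine integral_congr_ae (.of_forall fun z => ?_)
      exact (hrot z).symm
    rw [integral_neg] at key2
    linear_combination -(1 / 2 : ℂ) * key2

end Moments

/-! ### Wick's theorem -/

section Wick

open Finset

/-- The number of permutations that carry one labelling to another, counted label by label. The
right-hand side is the form in which the moments of independent Gaussians come. -/
theorem sum_perm_ite_eq_prod {ι κ : Type*} [Fintype ι] [DecidableEq ι] [Fintype κ] [DecidableEq κ]
    (a b : ι → κ) :
    ∑ γ : Equiv.Perm ι, (if ∀ k, a k = b (γ k) then (1 : ℂ) else 0) =
      ∏ c, if #{k | a k = c} = #{k | b k = c} then ((#{k | a k = c})! : ℂ) else 0 := by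
  by_cases h : ∃ γ₀ : Equiv.Perm ι, ∀ k, a k = b (γ₀ k)
  · obtain ⟨γ₀, h₀⟩ := h
    have hcard (c : κ) : #{k | a k = c} = #{k | b k = c} := by
      simp only [h₀]
      exact card_bij (fun k _ => γ₀ k) (by simp) (by simp) fun k hk =>
        ⟨γ₀.symm k, by simpa using hk, by simp⟩
    have hleft : ∑ γ : Equiv.Perm ι, (if ∀ k, a k = b (γ k) then (1 : ℂ) else 0) =
        ∑ γ : Equiv.Perm ι, if b ∘ γ = b then (1 : ℂ) else 0 := by
      refine Fintype.sum_equiv (Equiv.mulRight γ₀⁻¹) _ _ fun γ => ?_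
      congr 1
      simp only [h₀, funext_iff, eq_iff_iff, Function.comp_apply, Equiv.coe_mulRight,
        Equiv.Perm.mul_apply]
      refine ⟨fun h k => ?_, fun h k => ?_⟩
      · simpa using (h (γ₀⁻¹ k)).symm
      · simpa using (h (γ₀ k)).symm
    -- The permutations in question form a coset of the stabiliser of the labelling `b`.
    have hstab := DomMulAct.stabilizer_card b
    rw [hleft, sum_boole, ← Fintype.card_subtype, hstab]
    simp [hcard, Fintype.card_subtype]
  · push Not at h
    rw [sum_eq_zero fun γ _ => if_neg (by simpa using h γ)]
    by_contra hne
    have hcard (c : κ) : #{k | a k = c} = #{k | b k = c} := by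
      by_contra hc
      exact hne (prod_eq_zero (mem_univ c) (if_neg hc)).symm
    -- Labellings with fibres of the same sizes differ by a permutation.
    let e (c : κ) : {k // a k = c} ≃ {k // b k = c} := Fintype.equivOfCardEq (by
      simpa [Fintype.card_subtype] using hcard c)
    let γ : Equiv.Perm ι := (Equiv.sigmaFiberEquiv a).symm.trans
      ((Equiv.sigmaCongrRight e).trans (Equiv.sigmaFiberEquiv b))
    obtain ⟨k, hk⟩ := h γ
    exact hk (e (a k) ⟨k, rfl⟩).2.symm

theorem prod_eq_prod_pow_card {ι κ : Type*} [Fintype ι] [Fintype κ] [DecidableEq κ]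
    (a : ι → κ) (f : κ → ℂ) : ∏ k, f (a k) = ∏ c, f c ^ #{k | a k = c} := by
  rw [← prod_fiberwise univ a]
  refine prod_congr rfl fun c _ => ?_
  rw [prod_congr rfl (g := fun _ => f c), prod_const]
  intro k hk
  rw [(mem_filter.1 hk).2]

/-- Wick's theorem for one matrix of independent standard complex Gaussian entries. -/
theorem hasMoment_wick {ι : Type*} [Fintype ι] [DecidableEq ι] {N : ℕ} (I P J Q : ι → Fin N) :
    HasMoment (fun x : Fin N → Fin N → ℂ => ∏ i, ∏ j, gaussWeight (x i j))
      (fun x => (∏ k, x (I k) (P k)) * ∏ k, conj (x (J k) (Q k)))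
      (∑ γ : Equiv.Perm ι, if ∀ k, I k = J (γ k) ∧ P k = Q (γ k) then 1 else 0) := by
  let a : ι → Fin N × Fin N := fun k => (I k, P k)
  let b : ι → Fin N × Fin N := fun k => (J k, Q k)
  have h := HasMoment.pi fun i : Fin N => HasMoment.pi fun j : Fin N =>
    hasMoment_gaussWeight #{k | a k = (i, j)} #{k | b k = (i, j)}
  convert h using 1
  · ext x
    have h1 := prod_eq_prod_pow_card a fun c => x c.1 c.2
    have h2 := prod_eq_prod_pow_card b fun c => conj (x c.1 c.2)
    simp only [Fintype.prod_prod_type, a, b] at h1 h2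
    rw [h1, h2]
    simp only [prod_mul_distrib, a, b]
  · have h3 := sum_perm_ite_eq_prod a b
    rw [Fintype.prod_prod_type] at h3
    rw [← h3]
    simp [a, b, Prod.ext_iff]

/-- Wick's theorem for independent matrices of standard complex Gaussian entries: only the
permutations within the blocks contribute. -/
theorem hasMoment_wick_blocks {l N : ℕ} {m : Fin l → ℕ} (I P J Q : Slot m → Fin N) :
    HasMoment (fun x : Fin l → Fin N → Fin N → ℂ => ∏ α, ∏ i, ∏ j, gaussWeight (x α i j))
      (fun x => (∏ k, x k.1 (I k) (P k)) * ∏ k, conj (x k.1 (J k) (Q k)))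
      (∑ γ : (α : Fin l) → SymGroup (Fin (m α)),
        if I = J ∘ (blockPerm γ).unop ∧ P = Q ∘ (blockPerm γ).unop then 1 else 0) := by
  have h := HasMoment.pi fun α : Fin l => hasMoment_wick (fun k => I ⟨α, k⟩) (fun k => P ⟨α, k⟩)
    (fun k => J ⟨α, k⟩) (fun k => Q ⟨α, k⟩)
  convert h using 1
  · ext x
    simp only [Fintype.prod_sigma, prod_mul_distrib]
  · rw [prod_univ_sum, Fintype.piFinset_univ]
    refine Fintype.sum_equiv (Equiv.piCongrRight fun _ => MulOpposite.opEquiv.symm) _ _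
      fun γ => ?_
    simp only [funext_iff, ← forall_and, Sigma.forall]
    split_ifs with hγ
    · exact (prod_eq_one fun α _ => if_pos (hγ α)).symm
    · push Not at hγ
      obtain ⟨α, k, hk⟩ := hγ
      exact (prod_eq_zero (mem_univ α) (if_neg fun hα => hk (hα k).1 (hα k).2)).symm

end Wick

/-! ### Two-point functions of the permutation basis -/

section Correlators

open MeasureTheory

variable {l N : ℕ} {m : Fin l → ℕ}

theorem weight_one_toMatrices (x : Fin l → Fin N → Fin N → ℂ) :
    weight (fun _ => 1) (toMatrices x) = ∏ α, ∏ i, ∏ j, gaussWeight (x α i j) := by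
  simp only [weight, gaussWeight, toMatrices, ← Complex.exp_sum, Finset.sum_neg_distrib]
  simp [Matrix.trace, Matrix.mul_apply]

theorem permObs_mul (σ : SymGroup (Slot m)) (X A : Fin l → Matrix (Fin N) (Fin N) ℂ) :
    permObs σ (fun η => X η * A η) = ∑ I : Slot m → Fin N, ∑ P : Slot m → Fin N,
      (∏ k, A k.1 (P k) (I (σ.unop k))) * ∏ k, X k.1 (I k) (P k) := by
  rw [permObs_eq]
  refine Finset.sum_congr rfl fun I _ => ?_
  simp only [Matrix.mul_apply, Finset.prod_univ_sum, Fintype.piFinset_univ,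
    ← Finset.prod_mul_distrib]
  exact Finset.sum_congr rfl fun P _ => Finset.prod_congr rfl fun k _ => mul_comm _ _

theorem prod_sigmaCongrRight (γ : (α : Fin l) → Equiv.Perm (Fin (m α)))
    (f : Fin l → Slot m → ℂ) :
    ∏ k : Slot m, f k.1 (Equiv.Perm.sigmaCongrRight γ k) = ∏ k : Slot m, f k.1 k :=
  Fintype.prod_equiv (Equiv.Perm.sigmaCongrRight γ) _ _ fun _ => rfl

/-- The contraction of the index lines in one term of Wick's theorem is again a gauge-invariant
operator, evaluated at `A† A`. The products of permutations are those of `SymGroup`, in which the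
leftmost factor acts first. -/
theorem sum_contraction (σ τ : SymGroup (Slot m)) (γ : (α : Fin l) → SymGroup (Fin (m α)))
    (A : Fin l → Matrix (Fin N) (Fin N) ℂ) :
    ∑ J : Slot m → Fin N, ∑ Q : Slot m → Fin N,
      (∏ k, A k.1 (Q ((blockPerm γ).unop k)) (J ((blockPerm γ).unop (σ.unop k)))) *
        conj (∏ k, A k.1 (Q k) (J (τ.unop k))) =
      permObs ((blockPerm γ)⁻¹ * σ * blockPerm γ * τ⁻¹)
        (fun η => (A η).conjTranspose * A η) := by
  set g : Equiv.Perm (Slot m) := (blockPerm γ).unop with hg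
  have hblock (J Q : Slot m → Fin N) : ∏ k, A k.1 (Q (g k)) (J (g (σ.unop k))) =
      ∏ k : Slot m, A k.1 (Q k) (J (g (σ.unop (g⁻¹ k)))) := by
    have := prod_sigmaCongrRight (fun α => (γ α).unop)
      fun α k => A α (Q k) (J (g (σ.unop (g⁻¹ k))))
    rw [← this]
    refine Finset.prod_congr rfl fun k _ => ?_
    change _ = A k.1 (Q (g k)) (J (g (σ.unop (g⁻¹ (g k)))))
    simp
  rw [permObs_eq]
  -- The new multi-index on the right-hand side is `J ∘ τ`.
  refine Fintype.sum_equiv (Equiv.arrowCongr τ.unop⁻¹ (Equiv.refl _)) _ _ fun J => ?_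
  have hB (k : Slot m) (i j : Fin N) : ((A k.1).conjTranspose * A k.1) i j =
      ∑ q, A k.1 q j * conj (A k.1 q i) := by
    simp [Matrix.mul_apply, mul_comm]
  simp only [hB, Finset.prod_univ_sum, Fintype.piFinset_univ, hblock, map_prod,
    ← Finset.prod_mul_distrib]
  refine Finset.sum_congr rfl fun Q _ => Finset.prod_congr rfl fun k _ => ?_
  simp [hg, Equiv.arrowCongr, Equiv.Perm.inv_def]

/-- Summing a kernel against pairings `I = u γ J`, `P = u γ Q` eliminates `I` and `P`. -/
theorem sum_mul_sum_ite {T Γ : Type*} [Fintype T] [DecidableEq T] [Fintype Γ] (u : Γ → T → T)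
    (f : T → T → T → T → ℂ) :
    ∑ I, ∑ P, ∑ J, ∑ Q, f I P J Q * ∑ γ, (if I = u γ J ∧ P = u γ Q then (1 : ℂ) else 0) =
      ∑ γ, ∑ J, ∑ Q, f (u γ J) (u γ Q) J Q := by
  have h : ∑ z : T × T, ∑ y : T × T, f z.1 z.2 y.1 y.2 *
      ∑ γ, (if z.1 = u γ y.1 ∧ z.2 = u γ y.2 then (1 : ℂ) else 0) =
      ∑ γ, ∑ y : T × T, f (u γ y.1) (u γ y.2) y.1 y.2 := by
    rw [Finset.sum_comm, Finset.sum_comm (s := (Finset.univ : Finset Γ))]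
    refine Finset.sum_congr rfl fun y _ => ?_
    simp only [Finset.mul_sum]
    rw [Finset.sum_comm]
    refine Finset.sum_congr rfl fun γ _ => ?_
    rw [Finset.sum_eq_single (u γ y.1, u γ y.2)]
    · simp
    · intro z _ hz
      rw [if_neg fun hz' => hz (Prod.ext hz'.1 hz'.2), mul_zero]
    · simp
  simpa only [Fintype.sum_prod_type] using h

/-- The two-point function of the operators `𝓞_σ` and `𝓞_τ` with classical witnesses `A`. -/
theorem hasMoment_permObs (σ τ : SymGroup (Slot m)) (A : Fin l → Matrix (Fin N) (Fin N) ℂ) :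
    HasMoment (fun x : Fin l → Fin N → Fin N → ℂ => ∏ α, ∏ i, ∏ j, gaussWeight (x α i j))
      (fun x => permObs σ (fun η => toMatrices x η * A η) *
        conj (permObs τ (fun η => toMatrices x η * A η)))
      (∑ γ : (α : Fin l) → SymGroup (Fin (m α)),
        permObs ((blockPerm γ)⁻¹ * σ * blockPerm γ * τ⁻¹)
          (fun η => (A η).conjTranspose * A η)) := by
  have h := HasMoment.sum Finset.univ fun (I : Slot m → Fin N) _ =>
    HasMoment.sum Finset.univ fun (P : Slot m → Fin N) _ =>
    HasMoment.sum Finset.univ fun (J : Slot m → Fin N) _ =>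
    HasMoment.sum Finset.univ fun (Q : Slot m → Fin N) _ =>
    (hasMoment_wick_blocks (m := m) I P J Q).const_mul
      ((∏ k, A k.1 (P k) (I (σ.unop k))) * conj (∏ k, A k.1 (Q k) (J (τ.unop k))))
  convert h using 1
  · ext x
    rw [permObs_mul, permObs_mul, map_sum, Finset.sum_mul_sum]
    refine Finset.sum_congr rfl fun I _ => ?_
    rw [Finset.sum_comm]
    refine Finset.sum_congr rfl fun J _ => ?_
    rw [map_sum, Finset.sum_mul_sum]
    refine Finset.sum_congr rfl fun P _ => Finset.sum_congr rfl fun Q _ => ?_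
    simp only [toMatrices, Matrix.of_apply, map_mul, map_prod]
    ring
  · rw [sum_mul_sum_ite fun γ (J : Slot m → Fin N) => J ∘ (blockPerm γ).unop]
    exact Finset.sum_congr rfl fun γ _ => (sum_contraction σ τ γ A).symm

end Correlators

/-! ### Two-point functions of the Fourier basis -/

section Fourier

variable {l N : ℕ} {m : Fin l → ℕ} {D : BigIrreps m} {E : BlockIrreps m}
  {R S : Nat.Partition (∑ α, m α)}

theorem AdaptedBasis.fourierObs_eq (b : AdaptedBasis D E R) (r : BlockLabel m)
    (μ ν : Fin (b.mult r)) (X : Fin l → Matrix (Fin N) (Fin N) ℂ) :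
    b.fourierObs r μ ν X = ((D.dim R : ℂ) / ((∑ α, m α)! : ℂ)) *
      ∑ σ : SymGroup (Slot m), b.restrictedChar r μ ν σ⁻¹ * permObs σ X := by
  rw [fourierObs, ← MulOpposite.opEquiv.sum_comp, Finset.mul_sum]
  refine Finset.sum_congr rfl fun π _ => ?_
  rw [← mul_assoc]
  congr 1
  simp only [delta, Q, smul_mul_assoc, Finset.sum_mul, MonoidAlgebra.single_mul_single, mul_one]
  have hcoeff (c : Equiv.Perm (Slot m)) (z : ℂ) : (MonoidAlgebra.single
      ((MulOpposite.op c)⁻¹ * (MulOpposite.op π)⁻¹) z).coeff (1 : SymGroup (Slot m)) =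
      if c = π⁻¹ then z else 0 := by
    rw [MonoidAlgebra.coeff_single, Finsupp.single_apply]
    congr 1
    rw [← mul_inv_rev, inv_eq_one, ← MulOpposite.op_mul, MulOpposite.op_eq_one_iff,
      mul_eq_one_iff_eq_inv, eq_iff_iff]
  simp only [MonoidAlgebra.coeff_smul, MonoidAlgebra.coeff_sum, Finsupp.smul_apply,
    Finsupp.finsetSum_apply, hcoeff, smul_eq_mul]
  simp

/-- The two-point function of the Fourier operators before Schur orthogonality is applied: the sum
over Wick contractions has become the order of the block subgroup. -/
theorem hasMoment_fourierObs (b : AdaptedBasis D E R) (c : AdaptedBasis D E S)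
    (r s : BlockLabel m) (μ₁ ν₁ : Fin (b.mult r)) (μ₂ ν₂ : Fin (c.mult s))
    (A : Fin l → Matrix (Fin N) (Fin N) ℂ) :
    HasMoment (fun x : Fin l → Fin N → Fin N → ℂ => ∏ α, ∏ i, ∏ j, gaussWeight (x α i j))
      (fun x => b.fourierObs r μ₁ ν₁ (fun η => toMatrices x η * A η) *
        conj (c.fourierObs s μ₂ ν₂ (fun η => toMatrices x η * A η)))
      ((∏ α, ((m α)! : ℂ)) * ((D.dim R : ℂ) / ((∑ α, m α)! : ℂ)) *
        ((D.dim S : ℂ) / ((∑ α, m α)! : ℂ)) *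
        ∑ ρ, (∑ τ, b.restrictedChar r μ₁ ν₁ (τ⁻¹ * ρ⁻¹) * c.restrictedChar s ν₂ μ₂ τ) *
          permObs ρ (fun η => (A η).conjTranspose * A η)) := by
  have h := HasMoment.sum Finset.univ fun (σ : SymGroup (Slot m)) _ =>
    HasMoment.sum Finset.univ fun (τ : SymGroup (Slot m)) _ =>
    (hasMoment_permObs σ τ A).const_mul (((D.dim R : ℂ) / ((∑ α, m α)! : ℂ)) *
        ((D.dim S : ℂ) / ((∑ α, m α)! : ℂ)) *
        (b.restrictedChar r μ₁ ν₁ σ⁻¹ * c.restrictedChar s ν₂ μ₂ τ))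
  convert h using 1
  · ext x
    simp only [AdaptedBasis.fourierObs_eq, map_mul, map_sum, map_div₀, Complex.conj_natCast,
      AdaptedBasis.conj_restrictedChar, inv_inv, Finset.mul_sum, Finset.sum_mul]
    rw [Finset.sum_comm]
    refine Finset.sum_congr rfl fun σ _ => Finset.sum_congr rfl fun τ _ => ?_
    ring
  · have hcard : Fintype.card ((α : Fin l) → SymGroup (Fin (m α))) = ∏ α, (m α)! := by
      rw [Fintype.card_pi]
      refine Finset.prod_congr rfl fun α _ => ?_
      rw [Fintype.card_congr MulOpposite.opEquiv.symm, Fintype.card_perm, Fintype.card_fin]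
    have hγ (γ : (α : Fin l) → SymGroup (Fin (m α))) (τ : SymGroup (Slot m)) :
        ∑ σ, b.restrictedChar r μ₁ ν₁ σ⁻¹ * c.restrictedChar s ν₂ μ₂ τ *
          permObs ((blockPerm γ)⁻¹ * σ * blockPerm γ * τ⁻¹)
            (fun η => (A η).conjTranspose * A η) =
        ∑ ρ, b.restrictedChar r μ₁ ν₁ (τ⁻¹ * ρ⁻¹) * c.restrictedChar s ν₂ μ₂ τ *
          permObs ρ (fun η => (A η).conjTranspose * A η) := by
      -- The substitution `σ = γ ρ τ γ⁻¹`, for which `σ⁻¹` is conjugate to `τ⁻¹ ρ⁻¹` under `γ`.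
      symm
      refine Fintype.sum_equiv ((Equiv.mulRight τ).trans
        ((Equiv.mulLeft (blockPerm γ)).trans (Equiv.mulRight (blockPerm γ)⁻¹))) _ _ fun ρ => ?_
      have h1 := b.restrictedChar_conj r μ₁ ν₁ γ (τ⁻¹ * ρ⁻¹)
      rw [← h1]
      simp only [Equiv.trans_apply, Equiv.coe_mulRight, Equiv.coe_mulLeft]
      congr 3; group
    have hsum (τ : SymGroup (Slot m)) :
        ∑ σ, b.restrictedChar r μ₁ ν₁ σ⁻¹ * c.restrictedChar s ν₂ μ₂ τ *
          ∑ γ : (α : Fin l) → SymGroup (Fin (m α)),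
            permObs ((blockPerm γ)⁻¹ * σ * blockPerm γ * τ⁻¹)
              (fun η => (A η).conjTranspose * A η) =
        (∏ α, ((m α)! : ℂ)) * ∑ ρ, b.restrictedChar r μ₁ ν₁ (τ⁻¹ * ρ⁻¹) *
          c.restrictedChar s ν₂ μ₂ τ * permObs ρ (fun η => (A η).conjTranspose * A η) := by
      simp only [Finset.mul_sum (s := (Finset.univ : Finset ((α : Fin l) → SymGroup (Fin (m α)))))]
      rw [Finset.sum_comm, Finset.sum_congr rfl fun γ _ => hγ γ τ, Finset.sum_const,
        Finset.card_univ, hcard, nsmul_eq_mul, Nat.cast_prod]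
    rw [Finset.sum_comm]
    simp only [mul_assoc, ← Finset.mul_sum] at hsum ⊢
    simp only [hsum, ← Finset.mul_sum, Finset.sum_mul]
    rw [Finset.sum_comm]
    simp only [mul_assoc]
    ring

end Fourier

section Orthogonality

variable {l N : ℕ} {m : Fin l → ℕ} {D : BigIrreps m} {E : BlockIrreps m}

theorem IrrepSystem.dim_ne_zero {G Λ : Type} [Group G] (D : IrrepSystem G Λ) (R : Λ) :
    D.dim R ≠ 0 := by
  intro h
  have := D.irreducible R
  have hsub : Subsingleton (EuclideanSpace ℂ (Fin (D.dim R))) := by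
    rw [h]; infer_instance
  obtain ⟨p, q, hpq⟩ := exists_pair_ne (Subrepresentation (D.rep R))
  apply hpq
  ext v
  simp [Subsingleton.elim v 0]

/-- Orthogonality of the Fourier basis for the standard Gaussian average with classical witnesses
`A`. -/
theorem hasMoment_orthogonalValue (b : (R : Nat.Partition (∑ α, m α)) → AdaptedBasis D E R)
    {R S : Nat.Partition (∑ α, m α)} {r s : BlockLabel m}
    (μ₁ ν₁ : Fin ((b R).mult r)) (μ₂ ν₂ : Fin ((b S).mult s))
    (A : Fin l → Matrix (Fin N) (Fin N) ℂ) :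
    HasMoment (fun x : Fin l → Fin N → Fin N → ℂ => ∏ α, ∏ i, ∏ j, gaussWeight (x α i j))
      (fun x => (b R).fourierObs r μ₁ ν₁ (fun η => toMatrices x η * A η) *
        conj ((b S).fourierObs s μ₂ ν₂ (fun η => toMatrices x η * A η)))
      (orthogonalValue b μ₁ ν₁ μ₂ ν₂ (fun η => (A η).conjTranspose * A η)) := by
  convert hasMoment_fourierObs (b R) (b S) r s μ₁ ν₁ μ₂ ν₂ A using 1
  have hfact : (((∑ α, m α)! : ℕ) : ℂ) ≠ 0 := by exact_mod_cast Nat.factorial_ne_zero _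
  by_cases hRS : R = S
  swap
  · simp [orthogonalValue, hRS, sum_restrictedChar_mul_of_ne hRS]
  subst hRS
  have hdim : (D.dim R : ℂ) ≠ 0 := by exact_mod_cast D.dim_ne_zero R
  by_cases hrs : r = s
  swap
  · have h0 (x) := (mul_eq_zero.1 ((b R).dim_mul_sum_restrictedChar_mul_of_ne hrs
      μ₁ ν₁ μ₂ ν₂ x)).resolve_left hdim
    simp [orthogonalValue, hrs, h0]
  subst hrs
  have h1 (x) : ∑ τ, (b R).restrictedChar r μ₁ ν₁ (τ⁻¹ * x) * (b R).restrictedChar r ν₂ μ₂ τ =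
      if ν₁ = ν₂ then ((∑ α, m α)! / D.dim R : ℂ) * (b R).restrictedChar r μ₁ μ₂ x else 0 := by
    have := (b R).dim_mul_sum_restrictedChar_mul_self r μ₁ ν₁ μ₂ ν₂ x
    split_ifs at this ⊢
    · rw [div_mul_eq_mul_div, eq_div_iff hdim, mul_comm, this]
    · exact (mul_eq_zero.1 this).resolve_left hdim
  simp only [orthogonalValue, and_self, dif_pos, Fin.cast_eq_self, h1]
  split_ifs with hν
  · rw [AdaptedBasis.fourierObs_eq]
    simp only [mul_assoc, ← Finset.mul_sum]
    field_simp
  · simp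

end Orthogonality

/-! ### Gaussian averages with couplings -/

section Couplings

open MeasureTheory

variable {l N : ℕ}

theorem integral_prod_gaussWeight_ne_zero :
    ∫ x : Fin l → Fin N → Fin N → ℂ, ∏ α, ∏ i, ∏ j, gaussWeight (x α i j) ≠ 0 := by
  rw [integral_fintype_prod_volume_eq_prod
    fun (_ : Fin l) (y : Fin N → Fin N → ℂ) => ∏ i, ∏ j, gaussWeight (y i j)]
  rw [integral_fintype_prod_volume_eq_prod
    fun (_ : Fin N) (y : Fin N → ℂ) => ∏ j, gaussWeight (y j)]
  rw [integral_fintype_prod_volume_eq_prod fun (_ : Fin N) => gaussWeight]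
  simp [integral_gaussWeight, Real.pi_ne_zero]

theorem hasMoment_one :
    HasMoment (fun x : Fin l → Fin N → Fin N → ℂ => ∏ α, ∏ i, ∏ j, gaussWeight (x α i j))
      (fun _ => 1) 1 := by
  have h := HasMoment.pi fun _ : Fin l => HasMoment.pi fun _ : Fin N => HasMoment.pi
    fun _ : Fin N => hasMoment_gaussWeight 0 0
  simpa using h

instance {ι E : Type*} [Fintype ι] [NormedAddCommGroup E] [NormedSpace ℝ E]
    [FiniteDimensional ℝ E] [MeasureSpace E] [BorelSpace E]
    [(volume : Measure E).IsAddHaarMeasure] :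
    (volume : Measure (ι → E)).IsAddHaarMeasure :=
  inferInstanceAs (Measure.pi fun _ : ι => (volume : Measure E)).IsAddHaarMeasure

theorem HasMoment.hasCorrelator {A : Fin l → Matrix (Fin N) (Fin N) ℂ}
    {F : (Fin l → Matrix (Fin N) (Fin N) ℂ) → ℂ} {c : ℂ}
    (h : HasMoment (fun x => weight A (toMatrices x)) (fun x => F (toMatrices x)) c)
    (h1 : HasMoment (fun x => weight A (toMatrices x)) (fun _ => 1) 1)
    (h0 : ∫ x : Fin l → Fin N → Fin N → ℂ, weight A (toMatrices x) ≠ 0) :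
    HasCorrelator A F c :=
  ⟨by simpa using h1.1, h0, h.1, by rw [h.2, mul_div_cancel_right₀ _ h0]⟩

/-- Right multiplication of every matrix by an invertible matrix, as a real linear map of the
matrix entries. -/
def mulRightEquiv (C : Fin l → (Matrix (Fin N) (Fin N) ℂ)ˣ) :
    (Fin l → Fin N → Fin N → ℂ) ≃ₗ[ℝ] (Fin l → Fin N → Fin N → ℂ) where
  toFun x η i j := (toMatrices x η * (C η).1) i j
  invFun x η i j := (toMatrices x η * (C η)⁻¹.1) i j
  map_add' x y := by
    ext η i j
    simp [toMatrices, Matrix.mul_apply, add_mul, Finset.sum_add_distrib]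
  map_smul' a x := by
    ext η i j
    simp [toMatrices, Matrix.mul_apply, Finset.mul_sum, mul_assoc]
  left_inv x := by
    funext η
    have h : toMatrices x η * (C η).1 * (C η)⁻¹.1 = toMatrices x η := by
      rw [Matrix.mul_assoc, Units.mul_inv, Matrix.mul_one]
    exact h
  right_inv x := by
    funext η
    have h : toMatrices x η * (C η)⁻¹.1 * (C η).1 = toMatrices x η := by
      rw [Matrix.mul_assoc, Units.inv_mul, Matrix.mul_one]
    exact h

theorem toMatrices_mulRightEquiv (C : Fin l → (Matrix (Fin N) (Fin N) ℂ)ˣ)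
    (x : Fin l → Fin N → Fin N → ℂ) :
    toMatrices (mulRightEquiv C x) = fun η => toMatrices x η * (C η).1 := rfl

open scoped MatrixOrder in
theorem exists_unit_mul_conjTranspose {A : Matrix (Fin N) (Fin N) ℂ} (hA : A.PosDef) :
    ∃ C : (Matrix (Fin N) (Fin N) ℂ)ˣ, A = C.1 * C.1.conjTranspose := by
  obtain ⟨y, hy, rfl⟩ := CStarAlgebra.isStrictlyPositive_iff_eq_star_mul_self.mp
    hA.isStrictlyPositive
  obtain ⟨u, rfl⟩ := hy
  exact ⟨star u, by simp [Matrix.star_eq_conjTranspose]⟩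

theorem weight_mul_conjTranspose (C X : Fin l → Matrix (Fin N) (Fin N) ℂ) :
    weight (fun η => C η * (C η).conjTranspose) X = weight (fun _ => 1) (fun η => X η * C η) := by
  simp [weight, Matrix.conjTranspose_mul, Matrix.mul_assoc]

/-- Substituting `Y = X C` turns the average with couplings `C C†` into the standard one. -/
theorem hasCorrelator_mul_conjTranspose (C : Fin l → (Matrix (Fin N) (Fin N) ℂ)ˣ)
    {F : (Fin l → Matrix (Fin N) (Fin N) ℂ) → ℂ} {c : ℂ}
    (h : HasMoment (fun x : Fin l → Fin N → Fin N → ℂ => ∏ α, ∏ i, ∏ j, gaussWeight (x α i j))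
      (fun x => F (fun η => toMatrices x η * (C η)⁻¹.1)) c) :
    HasCorrelator (fun η => (C η).1 * (C η).1.conjTranspose) F c := by
  have hw (x : Fin l → Fin N → Fin N → ℂ) :
      weight (fun η => (C η).1 * (C η).1.conjTranspose) (toMatrices x) =
        ∏ α, ∏ i, ∏ j, gaussWeight (mulRightEquiv C x α i j) := by
    rw [weight_mul_conjTranspose, ← weight_one_toMatrices, toMatrices_mulRightEquiv]
  have hF (x : Fin l → Fin N → Fin N → ℂ) : F (toMatrices x) =
      F (fun η => toMatrices (mulRightEquiv C x) η * (C η)⁻¹.1) := by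
    simp only [toMatrices_mulRightEquiv, Matrix.mul_assoc]
    simp
  apply HasMoment.hasCorrelator
  · simp only [hw, hF]
    exact h.comp_linearEquiv (mulRightEquiv C)
  · simp only [hw]
    exact hasMoment_one.comp_linearEquiv (mulRightEquiv C)
  · simp only [hw]
    exact integral_comp_linearEquiv_ne_zero (mulRightEquiv C) integral_prod_gaussWeight_ne_zero

end Couplings

end MultiMatrix

end

theorem mainTheorem8 (l N : ℕ) (m : Fin l → ℕ)
    (D : MultiMatrix.BigIrreps m) (E : MultiMatrix.BlockIrreps m)
    (b : (R : Nat.Partition (∑ α, m α)) → MultiMatrix.AdaptedBasis D E R)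
    (R S : Nat.Partition (∑ α, m α)) (r s : MultiMatrix.BlockLabel m)
    (μ₁ ν₁ : Fin ((b R).mult r)) (μ₂ ν₂ : Fin ((b S).mult s))
    (A : Fin l → Matrix (Fin N) (Fin N) ℂ) :
    ((∀ η, (A η).PosDef) →
      MultiMatrix.HasCorrelator A
        (fun X => (b R).fourierObs r μ₁ ν₁ X * conj ((b S).fourierObs s μ₂ ν₂ X))
        (MultiMatrix.orthogonalValue b μ₁ ν₁ μ₂ ν₂ (fun η => (A η)⁻¹))) ∧
    MultiMatrix.HasCorrelator (fun _ => 1)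
      (fun X => (b R).fourierObs r μ₁ ν₁ (fun η => X η * A η) *
        conj ((b S).fourierObs s μ₂ ν₂ (fun η => X η * A η)))
      (MultiMatrix.orthogonalValue b μ₁ ν₁ μ₂ ν₂
        (fun η => (A η).conjTranspose * A η)) := by
  constructor
  · intro hA
    choose C hC using fun η => MultiMatrix.exists_unit_mul_conjTranspose (hA η)
    obtain rfl : A = fun η => (C η).1 * (C η).1.conjTranspose := funext hC
    apply MultiMatrix.hasCorrelator_mul_conjTranspose
    -- The inverse of `C C†` is `B† B` for `B = C⁻¹`.
    convert MultiMatrix.hasMoment_orthogonalValue b μ₁ ν₁ μ₂ ν₂ (fun η => (C η)⁻¹.1) using 3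
    rw [Matrix.mul_inv_rev, ← Matrix.conjTranspose_nonsing_inv]
    simp [Matrix.coe_units_inv]
  · have h := MultiMatrix.hasCorrelator_mul_conjTranspose (fun _ => 1)
      (F := fun X => (b R).fourierObs r μ₁ ν₁ (fun η => X η * A η) *
        conj ((b S).fourierObs s μ₂ ν₂ (fun η => X η * A η)))
      (by simpa using MultiMatrix.hasMoment_orthogonalValue b μ₁ ν₁ μ₂ ν₂ A)
    simpa using h
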